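/- Let $L,\beta,\alpha>0$ and $\gamma\in\mathbb R$. Equip $H^1_0=H_0^1([0,L])$ with the norm $\|u\|_{H^1}^2=\int_0^L u^2\,d\xi+\frac{\beta}{6}\int_0^L (u')^2\,d\xi$, and let $N_0,V_0\in H_0^1$. For $T>0$ and $c\in L^2(0,L)$ let $(N(\cdot,\cdot;c),V(\cdot,\cdot;c))$ be the solution on $[0,L]\times[0,T]$ of $$N_t+V_\xi-\tfrac{\beta}{6}N_{\xi\xi t}=0,\qquad V_t+(cN)_\xi-\tfrac{\beta}{6}V_{\xi\xi t}=0,$$ with $N(\cdot,0)=N_0$, $V(\cdot,0)=V_0$ and homogeneous Dirichlet conditions at $\xi=0$ and $\xi=L$, in the following weak sense: $N,V:[0,T]\to H_0^1$ are differentiable in the $H^1$ norm, and for all $t\in[0,T]$ and $\phi,\psi\in H_0^1$ $$\int_0^L N_t\phi\,d\xi-\int_0^L V\phi_\xi\,d\xi+\tfrac{\beta}{6}\int_0^L N_{\xi t}\phi_\xi\,d\xi=0,\qquad \int_0^L V_t\psi\,d\xi-\int_0^L cN\psi_\xi\,d\xi+\tfrac{\beta}{6}\int_0^L V_{\xi t}\psi_\xi\,d\xi=0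 .$$ Let $\mathcal M_\gamma=\{c\in L^2(0,L):\|c\|_{L^2}\le\gamma\}$. For a measurement $m=(m_1,m_2)\in H_0^1\times H_0^1$, the restricted minimization problem (RMP) with final time $T$ is to minimize over $c\in\mathcal M_\gamma$ $$J_\alpha(c)=\tfrac12\|N(\cdot,T;c)-m_1\|_{H^1}^2+\tfrac12\|V(\cdot,T;c)-m_2\|_{H^1}^2+\tfrac{\alpha}{2}\|c\|_{L^2}^2 .$$ Let $m,\tilde m\in H_0^1\times H_0^1$ be measurements with $m(\xi)=\tilde m(\xi)$ for all $\xi\in[0,L]$. Then there is $T_0>0$, depending only on $L,\beta,\alpha,\gamma,N_0,V_0$ and the measurements, such that for every $T\in(0,T_0]$: if $c,\tilde c\in\mathcal M_\gamma$ are optimal solutions of the RMP with final time $T$ associated with $m$ and $\tilde m$ respectively, then $c(\xi)=\tilde c(\xi)$ for almost every $\xi\in[0,L]$. In other words, the RMP has at most one solution for small final times. -/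

import Mathlib

open MeasureTheory Set Filter Topology

namespace Boussinesq

/-- Membership in `L²([0,L])` of a real function (its values outside `[0,L]` are irrelevant). -/
def MemL2 (L : ℝ) (c : ℝ → ℝ) : Prop :=
  MemLp c 2 (volume.restrict (Icc 0 L))

/-- The usual norm of `L²([0,L])`. -/
noncomputable def l2Norm (L : ℝ) (c : ℝ → ℝ) : ℝ :=
  Real.sqrt (∫ x in (0 : ℝ)..L, c x ^ 2)

/-- Membership in `H₀¹([0,L])`: in one dimension an element of `H¹([0,L])` is (represented by) an
absolutely continuous function on `[0,L]` whose a.e. derivative, which is its weak derivative, is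
square integrable; it lies in `H₀¹` when it vanishes at `0` and at `L`. -/
structure MemH10 (L : ℝ) (u : ℝ → ℝ) : Prop where
  absCont : AbsolutelyContinuousOnInterval u 0 L
  memL2_deriv : MemL2 L (deriv u)
  left : u 0 = 0
  right : u L = 0

/-- The weighted norm `(∫₀ᴸ u² + (β/6) ∫₀ᴸ (u')²)^{1/2}` of `H¹([0,L])`. -/
noncomputable def h1Norm (L β : ℝ) (u : ℝ → ℝ) : ℝ :=
  Real.sqrt ((∫ x in (0 : ℝ)..L, u x ^ 2) + β / 6 * ∫ x in (0 : ℝ)..L, deriv u x ^ 2)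

/-- `w` is the derivative at time `t ∈ [0,T]` of the curve `s ↦ u s` in `H₀¹([0,L])` (one-sided at
the ends of `[0,T]`), in the norm of `H¹`. -/
def HasTimeDeriv (L β T : ℝ) (u : ℝ → ℝ → ℝ) (w : ℝ → ℝ) (t : ℝ) : Prop :=
  Tendsto (fun s => h1Norm L β (fun x => (u s x - u t x) / (s - t) - w x))
    (𝓝[Icc 0 T \ {t}] t) (𝓝 0)

/-- `(N, V)` solves, on `[0,L] × [0,T]`, the linear Boussinesq system
`N_t + V_ξ - (β/6) N_{ξξt} = 0`, `V_t + (c N)_ξ - (β/6) V_{ξξt} = 0`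
with initial data `(N₀, V₀)` and homogeneous Dirichlet boundary conditions, in the weak form.
Here `N t ξ` and `V t ξ` are the values at time `t` and position `ξ`. -/
structure IsSolution (L β T : ℝ) (c N₀ V₀ : ℝ → ℝ) (N V : ℝ → ℝ → ℝ) : Prop where
  mem_N : ∀ t ∈ Icc 0 T, MemH10 L (N t)
  mem_V : ∀ t ∈ Icc 0 T, MemH10 L (V t)
  init_N : ∀ x ∈ Icc 0 L, N 0 x = N₀ x
  init_V : ∀ x ∈ Icc 0 L, V 0 x = V₀ x
  weak_eq : ∃ Nt Vt : ℝ → ℝ → ℝ, ∀ t ∈ Icc 0 T,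
    MemH10 L (Nt t) ∧ MemH10 L (Vt t) ∧
    HasTimeDeriv L β T N (Nt t) t ∧ HasTimeDeriv L β T V (Vt t) t ∧
    (∀ φ : ℝ → ℝ, MemH10 L φ →
      (∫ x in (0 : ℝ)..L, Nt t x * φ x) - (∫ x in (0 : ℝ)..L, V t x * deriv φ x)
        + β / 6 * (∫ x in (0 : ℝ)..L, deriv (Nt t) x * deriv φ x) = 0) ∧
    (∀ ψ : ℝ → ℝ, MemH10 L ψ →
      (∫ x in (0 : ℝ)..L, Vt t x * ψ x) - (∫ x in (0 : ℝ)..L, c x * N t x * deriv ψ x)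
        + β / 6 * (∫ x in (0 : ℝ)..L, deriv (Vt t) x * deriv ψ x) = 0)

/-- The admissible coefficients `{c ∈ L²(0,L) : ‖c‖_{L²} ≤ γ}`. -/
def Admissible (L γ : ℝ) (c : ℝ → ℝ) : Prop :=
  MemL2 L c ∧ l2Norm L c ≤ γ

/-- The Tikhonov functional, as a function of the coefficient `c`, of the state `(n, v)` at the
final time, and of the measurement `m = (m₁, m₂)`. -/
noncomputable def tikhonov (L β α : ℝ) (m : (ℝ → ℝ) × (ℝ → ℝ)) (c n v : ℝ → ℝ) : ℝ :=
  1 / 2 * h1Norm L β (fun x => n x - m.1 x) ^ 2 + 1 / 2 * h1Norm L β (fun x => v x - m.2 x) ^ 2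
    + α / 2 * l2Norm L c ^ 2

/-- `c` is an optimal solution of the restricted minimization problem with final time `T` and
measurement `m`: it is admissible and, together with the solution of the direct problem for `c`, it
minimizes the Tikhonov functional among all admissible coefficients, each taken with the solution
of its direct problem. -/
def IsOptimal (L β α γ T : ℝ) (N₀ V₀ : ℝ → ℝ) (m : (ℝ → ℝ) × (ℝ → ℝ)) (c : ℝ → ℝ) : Prop :=
  Admissible L γ c ∧ ∃ N V : ℝ → ℝ → ℝ, IsSolution L β T c N₀ V₀ N V ∧
    ∀ (c' : ℝ → ℝ) (N' V' : ℝ → ℝ → ℝ), Admissible L γ c' → IsSolution L β T c' N₀ V₀ N' V' →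
      tikhonov L β α m c (N T) (V T) ≤ tikhonov L β α m c' (N' T) (V' T)

end Boussinesq

open Boussinesq

/-! An element of H₀¹ is determined by its derivative, a mean-zero element of L². Inverting the
weighted H¹ form turns the weak system into a linear ODE X' = (A₀ + A₁c)X with bounded operators on
`MeanZero L × MeanZero L`, affine in the coefficient c (`IsSolution.exists_hasDerivWithinAt`, with
converse `isSolution_of_hasDerivWithinAt`).

Let d + h and d - h be two optimal coefficients, with states X and Y, and let Z be the state of the
midpoint d. The difference X - Y is forced by A₁h(X + Y), and X + Y - 2Z is forced by A₁h(X - Y).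
Two applications of Grönwall give ‖X(T) + Y(T) - 2Z(T)‖ ≤ K T ‖h‖²
(`exists_norm_second_difference_le`). So the misfit fails to be midpoint convex by at most a
multiple of T‖h‖², while the Tikhonov term is strongly convex and gains α‖h‖². For small T the gain
wins unless h = 0, because d is admissible and neither optimum can cost more than it
(`eq_of_cost_le_midpoint`, `exists_time_forall_eq_zero`). -/

namespace Boussinesq

/-! ### Primitives of L² functions and multiplication by an L² coefficient. -/

/-- The Hilbert space `L²([0,L])`. -/
abbrev L2Space (L : ℝ) : Type := Lp ℝ 2 (volume.restrict (Icc (0 : ℝ) L))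

/-- The primitive vanishing at `0`. -/
noncomputable def primitive (f : ℝ → ℝ) (x : ℝ) : ℝ := ∫ t in (0 : ℝ)..x, f t

variable {L : ℝ}

lemma intervalIntegral_eq_integral_restrict (hL : 0 ≤ L) (f : ℝ → ℝ) :
    ∫ x in (0 : ℝ)..L, f x = ∫ x, f x ∂(volume.restrict (Icc 0 L)) := by
  rw [intervalIntegral.integral_of_le hL, integral_Icc_eq_integral_Ioc]

lemma MemL2.intervalIntegrable (hL : 0 ≤ L) {f : ℝ → ℝ} (hf : MemL2 L f) :
    IntervalIntegrable f volume 0 L := by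
  rw [intervalIntegrable_iff_integrableOn_Icc_of_le hL]
  exact MemLp.integrable one_le_two hf

lemma L2Space.memL2 (f : L2Space L) : MemL2 L f := Lp.memLp f

lemma MemL2.absolutelyContinuousOnInterval_primitive (hL : 0 ≤ L) {f : ℝ → ℝ} (hf : MemL2 L f) :
    AbsolutelyContinuousOnInterval (primitive f) 0 L :=
  (hf.intervalIntegrable hL).absolutelyContinuousOnInterval_intervalIntegral (by simp)

lemma primitive_congr {f g : ℝ → ℝ} (hfg : f =ᵐ[volume.restrict (Icc 0 L)] g) {x : ℝ}
    (hx : x ∈ Icc 0 L) : primitive f x = primitive g x := by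
  refine intervalIntegral.integral_congr_ae_restrict ?_
  refine ae_mono (Measure.restrict_mono ?_ le_rfl) hfg
  rw [uIoc_of_le hx.1]
  exact fun y hy => ⟨hy.1.le, hy.2.trans hx.2⟩

/-- As a pairing with a fixed vector, the value at `x` is linear and bounded in the class `f`, with
no further almost-everywhere argument. -/
lemma primitive_eq_inner (f : L2Space L) {x : ℝ} (hx : x ∈ Icc 0 L) :
    primitive f x = inner ℝ (indicatorConstLp (μ := volume.restrict (Icc (0 : ℝ) L)) 2
      (measurableSet_Ioc (a := (0 : ℝ)) (b := x)) (measure_ne_top _ _) (1 : ℝ)) f := by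
  rw [L2.inner_indicatorConstLp_one, Measure.restrict_restrict measurableSet_Ioc,
    inter_eq_left.2, primitive, intervalIntegral.integral_of_le hx.1]
  exact fun y hy => ⟨hy.1.le, hy.2.trans hx.2⟩

/-- Cauchy–Schwarz against an indicator. This sup bound, the embedding of H¹ in L^∞, is what keeps
`c * u` in L² when `c` is only in L². -/
lemma exists_abs_primitive_le (L : ℝ) :
    ∃ C : ℝ, 0 ≤ C ∧ ∀ f : L2Space L, ∀ x ∈ Icc 0 L, |primitive f x| ≤ C * ‖f‖ := by
  refine ⟨(volume.restrict (Icc (0 : ℝ) L)).real univ ^ (1 / (2 : ENNReal).toReal), by positivity,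
    fun f x hx => ?_⟩
  rw [primitive_eq_inner f hx]
  refine (abs_real_inner_le_norm _ _).trans ?_
  gcongr
  rw [norm_indicatorConstLp (by simp) (by simp), norm_one, one_mul]
  gcongr
  · simp
  · exact subset_univ _

lemma aestronglyMeasurable_primitive (hL : 0 ≤ L) {f : ℝ → ℝ} (hf : MemL2 L f) :
    AEStronglyMeasurable (primitive f) (volume.restrict (Icc 0 L)) := by
  have := (hf.absolutelyContinuousOnInterval_primitive hL).continuousOn
  rw [uIcc_of_le hL] at this
  exact this.aestronglyMeasurable measurableSet_Icc

lemma ae_abs_mul_primitive_le {C : ℝ}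
    (hC : ∀ f : L2Space L, ∀ x ∈ Icc 0 L, |primitive f x| ≤ C * ‖f‖) (c : ℝ → ℝ) (f : L2Space L) :
    ∀ᵐ x ∂volume.restrict (Icc 0 L), ‖c x * primitive f x‖ ≤ C * ‖f‖ * ‖c x‖ := by
  filter_upwards [ae_restrict_mem measurableSet_Icc] with x hx
  rw [norm_mul, mul_comm]
  exact mul_le_mul_of_nonneg_right (hC f x hx) (norm_nonneg _)

lemma memLp_mul_primitive (hL : 0 ≤ L) (c f : L2Space L) :
    MemLp (fun x => c x * primitive f x) 2 (volume.restrict (Icc 0 L)) := by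
  obtain ⟨C, -, hC⟩ := exists_abs_primitive_le L
  exact MemLp.of_le_mul (Lp.memLp c)
    ((Lp.aestronglyMeasurable c).mul (aestronglyMeasurable_primitive hL f.memL2))
    (ae_abs_mul_primitive_le hC c f)

lemma ae_primitive_add (f g : L2Space L) :
    ∀ᵐ x ∂volume.restrict (Icc 0 L),
      primitive (f + g : L2Space L) x = primitive f x + primitive g x := by
  filter_upwards [ae_restrict_mem measurableSet_Icc] with x hx
  rw [primitive_eq_inner _ hx, primitive_eq_inner _ hx, primitive_eq_inner _ hx, inner_add_right]

lemma ae_primitive_smul (r : ℝ) (f : L2Space L) :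
    ∀ᵐ x ∂volume.restrict (Icc 0 L),
      primitive (r • f : L2Space L) x = r * primitive f x := by
  filter_upwards [ae_restrict_mem measurableSet_Icc] with x hx
  rw [primitive_eq_inner _ hx, primitive_eq_inner _ hx, real_inner_smul_right]

/-- The bilinear map `(c, f) ↦ c ∫₀ f` on `L²([0,L])`. -/
noncomputable def mulPrimitiveₗ (hL : 0 ≤ L) : L2Space L →ₗ[ℝ] L2Space L →ₗ[ℝ] L2Space L :=
  LinearMap.mk₂ ℝ (fun c f => (memLp_mul_primitive hL c f).toLp _)
    (fun c d f => by
      ext1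
      filter_upwards [(memLp_mul_primitive hL (c + d) f).coeFn_toLp,
        (memLp_mul_primitive hL c f).coeFn_toLp, (memLp_mul_primitive hL d f).coeFn_toLp,
        Lp.coeFn_add ((memLp_mul_primitive hL c f).toLp _) ((memLp_mul_primitive hL d f).toLp _),
        Lp.coeFn_add c d] with x h₁ h₂ h₃ h₄ h₅
      rw [h₄, h₁, h₅, Pi.add_apply, Pi.add_apply, h₂, h₃, add_mul])
    (fun r c f => by
      ext1
      filter_upwards [(memLp_mul_primitive hL (r • c) f).coeFn_toLp,
        (memLp_mul_primitive hL c f).coeFn_toLp,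
        Lp.coeFn_smul r ((memLp_mul_primitive hL c f).toLp _),
        Lp.coeFn_smul r c] with x h₁ h₂ h₃ h₄
      rw [h₃, h₁, h₄, Pi.smul_apply, Pi.smul_apply, h₂, smul_eq_mul, smul_eq_mul, mul_assoc])
    (fun c f g => by
      ext1
      filter_upwards [(memLp_mul_primitive hL c (f + g)).coeFn_toLp,
        (memLp_mul_primitive hL c f).coeFn_toLp, (memLp_mul_primitive hL c g).coeFn_toLp,
        Lp.coeFn_add ((memLp_mul_primitive hL c f).toLp _) ((memLp_mul_primitive hL c g).toLp _),
        ae_primitive_add f g] with x h₁ h₂ h₃ h₄ h₅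
      rw [h₄, h₁, h₅, Pi.add_apply, h₂, h₃, mul_add])
    (fun r c f => by
      ext1
      filter_upwards [(memLp_mul_primitive hL c (r • f)).coeFn_toLp,
        (memLp_mul_primitive hL c f).coeFn_toLp,
        Lp.coeFn_smul r ((memLp_mul_primitive hL c f).toLp _),
        ae_primitive_smul r f] with x h₁ h₂ h₃ h₄
      rw [h₃, h₁, h₄, Pi.smul_apply, h₂, smul_eq_mul, mul_left_comm])

/-- The bounded bilinear map `(c, f) ↦ c ∫₀ f` on `L²([0,L])`. -/
noncomputable def mulPrimitive (hL : 0 ≤ L) : L2Space L →L[ℝ] L2Space L →L[ℝ] L2Space L :=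
  LinearMap.mkContinuousOfExistsBound₂ (mulPrimitiveₗ hL) <| by
    obtain ⟨C, hC₀, hC⟩ := exists_abs_primitive_le L
    refine ⟨C, fun c f => ?_⟩
    have := Lp.norm_le_mul_norm_of_ae_le_mul (f := mulPrimitiveₗ hL c f) (g := c)
      (c := C * ‖f‖) ?_
    · linarith
    · filter_upwards [(memLp_mul_primitive hL c f).coeFn_toLp, ae_abs_mul_primitive_le hC c f]
        with x h₁ h₂
      change ‖(memLp_mul_primitive hL c f).toLp _ x‖ ≤ _
      rwa [h₁]

lemma mulPrimitive_ae_eq (hL : 0 ≤ L) (c f : L2Space L) :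
    mulPrimitive hL c f =ᵐ[volume.restrict (Icc 0 L)] fun x => c x * primitive f x :=
  (memLp_mul_primitive hL c f).coeFn_toLp

/-! ### H₀¹ modelled by mean-zero derivatives. -/

/-- The constant function `1` in `L²([0,L])`. -/
noncomputable def oneL2 (L : ℝ) : L2Space L := (memLp_const (1 : ℝ)).toLp _

lemma oneL2_ae_eq (L : ℝ) : oneL2 L =ᵐ[volume.restrict (Icc 0 L)] fun _ => (1 : ℝ) :=
  (memLp_const (1 : ℝ)).coeFn_toLp

lemma inner_eq_integral (f g : L2Space L) :
    inner ℝ f g = ∫ x, f x * g x ∂(volume.restrict (Icc 0 L)) := by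
  rw [L2.inner_def]
  refine integral_congr_ae (Eventually.of_forall fun x => ?_)
  simp [mul_comm]

/-- The square integrable functions of mean zero. -/
noncomputable abbrev MeanZero (L : ℝ) : Submodule ℝ (L2Space L) := (ℝ ∙ oneL2 L)ᗮ

lemma mem_meanZero_iff (hL : 0 ≤ L) (f : L2Space L) : f ∈ MeanZero L ↔ primitive f L = 0 := by
  rw [Submodule.mem_orthogonal_singleton_iff_inner_right, inner_eq_integral, primitive,
    intervalIntegral_eq_integral_restrict hL]
  refine Eq.congr (integral_congr_ae ?_) rfl
  filter_upwards [oneL2_ae_eq L] with x hx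
  rw [hx, one_mul]

/-- `u ∈ H₀¹([0,L])` has derivative `f`. -/
structure HasH10Deriv (L : ℝ) (u : ℝ → ℝ) (f : MeanZero L) : Prop where
  mem : MemH10 L u
  deriv_ae : deriv u =ᵐ[volume.restrict (Icc 0 L)] (f : L2Space L)

lemma MemH10.eq_primitive {u : ℝ → ℝ} (hu : MemH10 L u) {x : ℝ} (hx : x ∈ Icc 0 L) :
    u x = primitive (deriv u) x := by
  have h := (hu.absCont.mono (c := 0) (d := x) ?_).integral_deriv_eq_sub
  · rw [primitive, h, hu.left, sub_zero]
  · rw [uIcc_of_le hx.1, uIcc_of_le (hx.1.trans hx.2)]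
    exact Icc_subset_Icc_right hx.2

lemma MemH10.exists_hasH10Deriv (hL : 0 ≤ L) {u : ℝ → ℝ} (hu : MemH10 L u) :
    ∃ f : MeanZero L, HasH10Deriv L u f := by
  have h := hu.memL2_deriv.coeFn_toLp
  refine ⟨⟨hu.memL2_deriv.toLp _, (mem_meanZero_iff hL _).2 ?_⟩, hu, h.symm⟩
  rw [primitive_congr h (right_mem_Icc.2 hL), ← hu.eq_primitive (right_mem_Icc.2 hL), hu.right]

lemma HasH10Deriv.eq_primitive {u : ℝ → ℝ} {f : MeanZero L} (h : HasH10Deriv L u f) {x : ℝ}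
    (hx : x ∈ Icc 0 L) : u x = primitive (f : L2Space L) x := by
  rw [h.mem.eq_primitive hx, primitive_congr h.deriv_ae hx]

lemma hasH10Deriv_primitive (hL : 0 ≤ L) (f : MeanZero L) :
    HasH10Deriv L (primitive (f : L2Space L)) f := by
  have hd : deriv (primitive (f : L2Space L)) =ᵐ[volume.restrict (Icc 0 L)] (f : L2Space L) := by
    have h := ((f : L2Space L).memL2.intervalIntegrable hL).ae_hasDerivAt_integral
    filter_upwards [ae_restrict_of_ae h, ae_restrict_mem measurableSet_Icc] with x hx hxI
    rw [uIcc_of_le hL] at hx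
    exact (hx hxI 0 (left_mem_Icc.2 hL)).deriv
  exact ⟨⟨(f : L2Space L).memL2.absolutelyContinuousOnInterval_primitive hL,
    (memLp_congr_ae hd).2 (f : L2Space L).memL2, by simp [primitive],
    (mem_meanZero_iff hL _).1 f.2⟩, hd⟩

lemma MemH10.ae_differentiableAt (hL : 0 ≤ L) {u : ℝ → ℝ} (hu : MemH10 L u) :
    ∀ᵐ x ∂volume.restrict (Icc 0 L), DifferentiableAt ℝ u x := by
  filter_upwards [ae_restrict_of_ae hu.absCont.ae_differentiableAt,
    ae_restrict_mem measurableSet_Icc] with x hx hxI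
  exact hx (by rwa [uIcc_of_le hL])

lemma HasH10Deriv.sub (hL : 0 ≤ L) {u v : ℝ → ℝ} {f g : MeanZero L} (hu : HasH10Deriv L u f)
    (hv : HasH10Deriv L v g) : HasH10Deriv L (fun x => u x - v x) (f - g) := by
  have hd : deriv (fun x => u x - v x) =ᵐ[volume.restrict (Icc 0 L)]
      ((f - g : MeanZero L) : L2Space L) := by
    filter_upwards [hu.deriv_ae, hv.deriv_ae, hu.mem.ae_differentiableAt hL,
      hv.mem.ae_differentiableAt hL, Lp.coeFn_sub (f : L2Space L) g] with x h₁ h₂ h₃ h₄ h₅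
    rw [Submodule.coe_sub, h₅, Pi.sub_apply, ← h₁, ← h₂]
    exact deriv_fun_sub h₃ h₄
  exact ⟨⟨hu.mem.absCont.sub hv.mem.absCont, (memLp_congr_ae hd).2 (L2Space.memL2 _),
    by simp [hu.mem.left, hv.mem.left], by simp [hu.mem.right, hv.mem.right]⟩, hd⟩

lemma HasH10Deriv.const_mul (hL : 0 ≤ L) (r : ℝ) {u : ℝ → ℝ} {f : MeanZero L}
    (hu : HasH10Deriv L u f) : HasH10Deriv L (fun x => r * u x) (r • f) := by
  have hd : deriv (fun x => r * u x) =ᵐ[volume.restrict (Icc 0 L)]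
      ((r • f : MeanZero L) : L2Space L) := by
    filter_upwards [hu.deriv_ae, hu.mem.ae_differentiableAt hL,
      Lp.coeFn_smul r (f : L2Space L)] with x h₁ h₂ h₃
    rw [Submodule.coe_smul, h₃, Pi.smul_apply, ← h₁, deriv_const_mul _ h₂, smul_eq_mul]
  exact ⟨⟨hu.mem.absCont.const_mul r, (memLp_congr_ae hd).2 (L2Space.memL2 _),
    by simp [hu.mem.left], by simp [hu.mem.right]⟩, hd⟩

/-- Agreement on `[0,L]` controls `deriv` only at interior points, since values outside are
arbitrary; the endpoints form a null set. -/
lemma HasH10Deriv.unique {u v : ℝ → ℝ} {f g : MeanZero L} (hu : HasH10Deriv L u f)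
    (hv : HasH10Deriv L v g) (huv : ∀ x ∈ Icc 0 L, u x = v x) : f = g := by
  ext1
  ext1
  have hI : ∀ᵐ x ∂volume.restrict (Icc 0 L), x ∈ Ioo 0 L := by
    rw [← restrict_Ioo_eq_restrict_Icc]
    exact ae_restrict_mem measurableSet_Ioo
  filter_upwards [hu.deriv_ae, hv.deriv_ae, hI] with x h₁ h₂ hx
  rw [← h₁, ← h₂]
  refine EventuallyEq.deriv_eq ?_
  filter_upwards [Icc_mem_nhds hx.1 hx.2] with y hy using huv y hy

end Boussinesq

namespace Boussinesq

variable {L β : ℝ}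

/-! ### The weak system as a linear ODE with bounded operators. -/

/-- The operator taking the primitive, from functions of mean zero to `L²([0,L])`. -/
noncomputable def primitiveL (hL : 0 ≤ L) : MeanZero L →L[ℝ] L2Space L :=
  (mulPrimitive hL (oneL2 L)).comp (MeanZero L).subtypeL

lemma primitiveL_ae_eq (hL : 0 ≤ L) (f : MeanZero L) :
    primitiveL hL f =ᵐ[volume.restrict (Icc 0 L)] primitive (f : L2Space L) := by
  filter_upwards [mulPrimitive_ae_eq hL (oneL2 L) f, oneL2_ae_eq L] with x h₁ h₂
  change mulPrimitive hL (oneL2 L) f x = _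
  rw [h₁, h₂, one_mul]

lemma HasH10Deriv.ae_eq_primitiveL (hL : 0 ≤ L) {u : ℝ → ℝ} {f : MeanZero L}
    (hu : HasH10Deriv L u f) : u =ᵐ[volume.restrict (Icc 0 L)] primitiveL hL f := by
  filter_upwards [primitiveL_ae_eq hL f, ae_restrict_mem measurableSet_Icc] with x hx hxI
  rw [hx, hu.eq_primitive hxI]

/-- The inner product of a real inner product space as a bounded bilinear form. -/
noncomputable def realInnerL (F : Type*) [NormedAddCommGroup F] [InnerProductSpace ℝ F] :
    F →L[ℝ] F →L[ℝ] ℝ :=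
  (innerₗ F).mkContinuous₂ 1 fun x y => by
    rw [one_mul]
    exact norm_inner_le_norm x y

/-- The weighted `H¹` inner product, in terms of the derivatives. -/
noncomputable def energyForm (hL : 0 ≤ L) (β : ℝ) : MeanZero L →L[ℝ] MeanZero L →L[ℝ] ℝ :=
  (realInnerL (L2Space L)).bilinearComp (primitiveL hL) (primitiveL hL) +
    (β / 6) • realInnerL (MeanZero L)

lemma energyForm_apply (hL : 0 ≤ L) (β : ℝ) (f g : MeanZero L) :
    energyForm hL β f g =
      inner ℝ (primitiveL hL f) (primitiveL hL g) + β / 6 * inner ℝ (f : L2Space L) (g : L2Space L) :=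
  rfl

lemma energyForm_comm (hL : 0 ≤ L) (β : ℝ) (f g : MeanZero L) :
    energyForm hL β f g = energyForm hL β g f := by
  simp only [energyForm_apply, real_inner_comm]

/-- The norm of `MeanZero L` is the L² norm of the derivative, so the derivative term alone gives
coercivity; no Poincaré inequality is needed. -/
lemma norm_sq_le_energyForm (hL : 0 ≤ L) (β : ℝ) (f : MeanZero L) :
    β / 6 * ‖f‖ ^ 2 ≤ energyForm hL β f f := by
  rw [energyForm_apply, real_inner_self_eq_norm_sq, real_inner_self_eq_norm_sq, Submodule.coe_norm]
  nlinarith [sq_nonneg ‖primitiveL hL f‖]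

lemma energyForm_self_nonneg (hL : 0 ≤ L) (hβ : 0 ≤ β) (f : MeanZero L) :
    0 ≤ energyForm hL β f f :=
  le_trans (by positivity) (norm_sq_le_energyForm hL β f)

lemma isCoercive_energyForm (hL : 0 ≤ L) (hβ : 0 < β) : IsCoercive (energyForm hL β) :=
  ⟨β / 6, by positivity, fun f => by
    have := norm_sq_le_energyForm hL β f
    rwa [pow_two, ← mul_assoc] at this⟩

lemma HasH10Deriv.energyForm_eq (hL : 0 ≤ L) (β : ℝ) {u φ : ℝ → ℝ} {f g : MeanZero L}
    (hu : HasH10Deriv L u f) (hφ : HasH10Deriv L φ g) :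
    energyForm hL β f g = (∫ x in (0 : ℝ)..L, u x * φ x) +
      β / 6 * ∫ x in (0 : ℝ)..L, deriv u x * deriv φ x := by
  rw [energyForm_apply, inner_eq_integral, inner_eq_integral,
    intervalIntegral_eq_integral_restrict hL, intervalIntegral_eq_integral_restrict hL]
  refine congrArg₂ (· + β / 6 * ·) ?_ ?_
  · exact integral_congr_ae
      ((hu.ae_eq_primitiveL hL).symm.mul (hφ.ae_eq_primitiveL hL).symm)
  · exact integral_congr_ae (hu.deriv_ae.symm.mul hφ.deriv_ae.symm)

lemma HasH10Deriv.h1Norm_eq (hL : 0 ≤ L) (β : ℝ) {u : ℝ → ℝ} {f : MeanZero L}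
    (hu : HasH10Deriv L u f) : h1Norm L β u = Real.sqrt (energyForm hL β f f) := by
  rw [hu.energyForm_eq hL β hu, h1Norm]
  simp only [pow_two]

lemma HasH10Deriv.integral_coeff (hL : 0 ≤ L) {c u φ : ℝ → ℝ} {c' : L2Space L} {f g : MeanZero L}
    (hc : c =ᵐ[volume.restrict (Icc 0 L)] c')
    (hu : HasH10Deriv L u f) (hφ : HasH10Deriv L φ g) :
    ∫ x in (0 : ℝ)..L, c x * u x * deriv φ x =
      inner ℝ (mulPrimitive hL c' f) (g : L2Space L) := by
  rw [inner_eq_integral, intervalIntegral_eq_integral_restrict hL]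
  refine integral_congr_ae (EventuallyEq.mul ?_ hφ.deriv_ae)
  filter_upwards [hc, mulPrimitive_ae_eq hL c' f, ae_restrict_mem measurableSet_Icc]
    with x h₁ h₂ hx
  rw [h₂, h₁, hu.eq_primitive hx]

lemma HasH10Deriv.integral_mul_deriv (hL : 0 ≤ L) {u φ : ℝ → ℝ} {f g : MeanZero L}
    (hu : HasH10Deriv L u f) (hφ : HasH10Deriv L φ g) :
    ∫ x in (0 : ℝ)..L, u x * deriv φ x =
      inner ℝ (mulPrimitive hL (oneL2 L) f) (g : L2Space L) := by
  rw [← hu.integral_coeff hL (oneL2_ae_eq L).symm hφ]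
  simp only [one_mul]

/-- The solution operator of the variational problem `⟨w, φ⟩_{H¹} = ∫ f φ'` for all `φ`. -/
noncomputable def variationalSolution (hL : 0 ≤ L) (hβ : 0 < β) : L2Space L →L[ℝ] MeanZero L :=
  ((isCoercive_energyForm hL hβ).continuousLinearEquivOfBilin.symm :
    MeanZero L →L[ℝ] MeanZero L).comp (ContinuousLinearMap.adjoint (MeanZero L).subtypeL)

/-- Lax–Milgram; the adjoint of the inclusion turns a functional given by an L² vector into one
represented in `MeanZero L`. -/
lemma energyForm_eq_inner_iff (hL : 0 ≤ L) (hβ : 0 < β) (w : MeanZero L) (f : L2Space L) :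
    (∀ g : MeanZero L, energyForm hL β w g = inner ℝ f (g : L2Space L)) ↔
      w = variationalSolution hL hβ f := by
  rw [variationalSolution, ContinuousLinearMap.comp_apply, ContinuousLinearEquiv.coe_coe,
    ContinuousLinearEquiv.eq_symm_apply, ext_iff_inner_right (𝕜 := ℝ)]
  refine forall_congr' fun g => ?_
  rw [IsCoercive.continuousLinearEquivOfBilin_apply, ContinuousLinearMap.adjoint_inner_left]
  rfl

/-- The part of the evolution operator that does not depend on the coefficient. -/
noncomputable def freeOperator (hL : 0 ≤ L) (hβ : 0 < β) :
    (MeanZero L × MeanZero L) →L[ℝ] MeanZero L × MeanZero L :=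
  (ContinuousLinearMap.inl ℝ _ _).comp <| (variationalSolution hL hβ).comp <|
    (primitiveL hL).comp (ContinuousLinearMap.snd ℝ _ _)

/-- The part of the evolution operator that is linear in the coefficient. -/
noncomputable def coeffOperator (hL : 0 ≤ L) (hβ : 0 < β) :
    L2Space L →L[ℝ] (MeanZero L × MeanZero L) →L[ℝ] MeanZero L × MeanZero L :=
  (ContinuousLinearMap.compL ℝ (MeanZero L × MeanZero L) (L2Space L) (MeanZero L × MeanZero L)
    ((ContinuousLinearMap.inr ℝ _ _).comp (variationalSolution hL hβ))).comp <|
  (mulPrimitive hL).bilinearComp (ContinuousLinearMap.id ℝ _)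
    ((MeanZero L).subtypeL.comp (ContinuousLinearMap.fst ℝ _ _))

lemma freeOperator_add_coeffOperator_apply (hL : 0 ≤ L) (hβ : 0 < β) (c : L2Space L)
    (f g : MeanZero L) :
    (freeOperator hL hβ + coeffOperator hL hβ c) (f, g) =
      (variationalSolution hL hβ (mulPrimitive hL (oneL2 L) g),
        variationalSolution hL hβ (mulPrimitive hL c f)) := by
  have h : (freeOperator hL hβ + coeffOperator hL hβ c) (f, g) =
    (variationalSolution hL hβ (mulPrimitive hL (oneL2 L) g), 0) +
      (0, variationalSolution hL hβ (mulPrimitive hL c f)) := rfl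
  rw [h, Prod.mk_add_mk, add_zero, zero_add]

/-- Serves both equations: `F` is the flux term, and test functions correspond to their mean-zero
derivatives. -/
lemma weakForm_iff (hL : 0 ≤ L) (hβ : 0 < β) {w : ℝ → ℝ} {f : MeanZero L}
    (hw : HasH10Deriv L w f) {F : (ℝ → ℝ) → ℝ} {k : L2Space L}
    (hF : ∀ (φ : ℝ → ℝ) (g : MeanZero L), HasH10Deriv L φ g → F φ = inner ℝ k (g : L2Space L)) :
    (∀ φ : ℝ → ℝ, MemH10 L φ → (∫ x in (0 : ℝ)..L, w x * φ x) - F φ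
      + β / 6 * (∫ x in (0 : ℝ)..L, deriv w x * deriv φ x) = 0) ↔
      f = variationalSolution hL hβ k := by
  rw [← energyForm_eq_inner_iff]
  constructor
  · intro h g
    have hg := hasH10Deriv_primitive hL g
    have h₁ := h _ hg.mem
    rw [hF _ _ hg] at h₁
    rw [hw.energyForm_eq hL β hg]
    linarith
  · intro h φ hφ
    obtain ⟨g, hg⟩ := hφ.exists_hasH10Deriv hL
    have h₁ := h g
    rw [hw.energyForm_eq hL β hg] at h₁
    rw [hF _ _ hg]
    linarith

lemma tendsto_sqrt_energyForm_iff (hL : 0 ≤ L) (hβ : 0 < β) {ι : Type*} {l : Filter ι}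
    {F : ι → MeanZero L} :
    Tendsto (fun i => Real.sqrt (energyForm hL β (F i) (F i))) l (𝓝 0) ↔ Tendsto F l (𝓝 0) := by
  constructor
  · intro h
    rw [tendsto_zero_iff_norm_tendsto_zero]
    have h' := h.const_mul (Real.sqrt (β / 6))⁻¹
    rw [mul_zero] at h'
    refine squeeze_zero (fun _ => norm_nonneg _) (fun i => ?_) h'
    have hs : 0 < Real.sqrt (β / 6) := by positivity
    rw [le_inv_mul_iff₀ hs]
    refine Real.le_sqrt_of_sq_le ?_
    rw [mul_pow, Real.sq_sqrt (by positivity)]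
    exact norm_sq_le_energyForm hL β (F i)
  · intro h
    have hc : Continuous fun f : MeanZero L => Real.sqrt (energyForm hL β f f) := by fun_prop
    have := (hc.tendsto 0).comp h
    simpa [Function.comp_def] using this

lemma hasTimeDeriv_iff (hL : 0 ≤ L) (hβ : 0 < β) {T t : ℝ} (ht : t ∈ Icc 0 T)
    {u : ℝ → ℝ → ℝ} {w : ℝ → ℝ} {F : ℝ → MeanZero L} {g : MeanZero L}
    (hu : ∀ s ∈ Icc 0 T, HasH10Deriv L (u s) (F s)) (hw : HasH10Deriv L w g) :
    HasTimeDeriv L β T u w t ↔ HasDerivWithinAt F g (Icc 0 T) t := by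
  rw [HasTimeDeriv, hasDerivWithinAt_iff_tendsto_slope, ← tendsto_sub_nhds_zero_iff (u := slope F t),
    ← tendsto_sqrt_energyForm_iff hL hβ]
  refine tendsto_congr' ?_
  filter_upwards [self_mem_nhdsWithin] with s hs
  have h := (((hu s hs.1).sub hL (hu t ht)).const_mul hL (s - t)⁻¹).sub hL hw
  have h' := h.h1Norm_eq hL β
  simp only [inv_mul_eq_div] at h'
  rw [h']
  rfl

/-- The state in the phase space of a solution of the weak problem obeys a linear evolution
equation. -/
lemma IsSolution.exists_hasDerivWithinAt (hL : 0 ≤ L) (hβ : 0 < β) {T : ℝ} (hT : 0 ≤ T)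
    {c N₀ V₀ : ℝ → ℝ} {c' : L2Space L} (hc : c =ᵐ[volume.restrict (Icc 0 L)] c')
    {f₀ g₀ : MeanZero L} (hN₀ : HasH10Deriv L N₀ f₀) (hV₀ : HasH10Deriv L V₀ g₀)
    {N V : ℝ → ℝ → ℝ} (h : IsSolution L β T c N₀ V₀ N V) :
    ∃ X : ℝ → MeanZero L × MeanZero L, X 0 = (f₀, g₀) ∧
      (∀ t ∈ Icc 0 T, HasH10Deriv L (N t) (X t).1 ∧ HasH10Deriv L (V t) (X t).2) ∧
      ∀ t ∈ Icc 0 T, HasDerivWithinAt X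
        ((freeOperator hL hβ + coeffOperator hL hβ c') (X t)) (Icc 0 T) t := by
  choose! F hF using fun t ht => (h.mem_N t ht).exists_hasH10Deriv hL
  choose! G hG using fun t ht => (h.mem_V t ht).exists_hasH10Deriv hL
  have h0 : (0 : ℝ) ∈ Icc 0 T := left_mem_Icc.2 hT
  refine ⟨fun t => (F t, G t), ?_, fun t ht => ⟨hF t ht, hG t ht⟩, fun t ht => ?_⟩
  · exact Prod.ext ((hF 0 h0).unique hN₀ h.init_N) ((hG 0 h0).unique hV₀ h.init_V)
  · obtain ⟨Nt, Vt, hNV⟩ := h.weak_eq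
    obtain ⟨hNt, hVt, hdN, hdV, hwN, hwV⟩ := hNV t ht
    obtain ⟨f, hf⟩ := hNt.exists_hasH10Deriv hL
    obtain ⟨g, hg⟩ := hVt.exists_hasH10Deriv hL
    rw [weakForm_iff hL hβ hf (F := fun φ => ∫ x in (0 : ℝ)..L, V t x * deriv φ x)
      fun φ k hk => (hG t ht).integral_mul_deriv hL hk] at hwN
    rw [weakForm_iff hL hβ hg (F := fun φ => ∫ x in (0 : ℝ)..L, c x * N t x * deriv φ x)
      fun φ k hk => (hF t ht).integral_coeff hL hc hk] at hwV
    rw [hasTimeDeriv_iff hL hβ ht hF hf] at hdN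
    rw [hasTimeDeriv_iff hL hβ ht hG hg] at hdV
    rw [freeOperator_add_coeffOperator_apply, ← hwN, ← hwV]
    exact hdN.prodMk hdV

/-- Needed to make the midpoint coefficient a genuine competitor in the minimization: its ODE
trajectory must be a weak solution. -/
lemma isSolution_of_hasDerivWithinAt (hL : 0 ≤ L) (hβ : 0 < β) {T : ℝ}
    {c N₀ V₀ : ℝ → ℝ} {c' : L2Space L} (hc : c =ᵐ[volume.restrict (Icc 0 L)] c')
    {f₀ g₀ : MeanZero L} (hN₀ : HasH10Deriv L N₀ f₀) (hV₀ : HasH10Deriv L V₀ g₀)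
    {X : ℝ → MeanZero L × MeanZero L} (hX₀ : X 0 = (f₀, g₀))
    (hX : ∀ t ∈ Icc 0 T, HasDerivWithinAt X
      ((freeOperator hL hβ + coeffOperator hL hβ c') (X t)) (Icc 0 T) t) :
    IsSolution L β T c N₀ V₀ (fun t => primitive ((X t).1 : L2Space L))
      (fun t => primitive ((X t).2 : L2Space L)) := by
  have hp := hasH10Deriv_primitive hL
  refine ⟨fun t _ => (hp _).mem, fun t _ => (hp _).mem, fun x hx => ?_, fun x hx => ?_,
    fun t => primitive (variationalSolution hL hβ (mulPrimitive hL (oneL2 L) (X t).2) : L2Space L),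
    fun t => primitive (variationalSolution hL hβ (mulPrimitive hL c' (X t).1) : L2Space L),
    fun t ht => ⟨(hp _).mem, (hp _).mem, ?_, ?_, ?_, ?_⟩⟩
  · rw [hX₀, hN₀.eq_primitive hx]
  · rw [hX₀, hV₀.eq_primitive hx]
  · rw [hasTimeDeriv_iff hL hβ ht (fun s _ => hp (X s).1) (hp _)]
    have := (hX t ht).fst
    rwa [freeOperator_add_coeffOperator_apply] at this
  · rw [hasTimeDeriv_iff hL hβ ht (fun s _ => hp (X s).2) (hp _)]
    have := (hX t ht).snd
    rwa [freeOperator_add_coeffOperator_apply] at this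
  · exact (weakForm_iff hL hβ (hp _)
      (F := fun φ => ∫ x in (0 : ℝ)..L, primitive ((X t).2 : L2Space L) x * deriv φ x)
      fun φ k hk => (hp (X t).2).integral_mul_deriv hL hk).2 rfl
  · exact (weakForm_iff hL hβ (hp _)
      (F := fun φ => ∫ x in (0 : ℝ)..L, c x * primitive ((X t).1 : L2Space L) x * deriv φ x)
      fun φ k hk => (hp (X t).1).integral_coeff hL hc hk).2 rfl

end Boussinesq

namespace Boussinesq

/-! ### Linear evolution equations: Grönwall estimates and second differences. -/

section Evolution

variable {E : Type*} [NormedAddCommGroup E] [NormedSpace ℝ E]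

lemma exists_hasDerivWithinAt_of_linear [CompleteSpace E] (A : E →L[ℝ] E) (x₀ : E) (s : Set ℝ) :
    ∃ X : ℝ → E, X 0 = x₀ ∧ ∀ t, HasDerivWithinAt X (A (X t)) s t := by
  refine ⟨fun t => NormedSpace.exp (t • A) x₀, by simp, fun t => ?_⟩
  exact ((hasDerivAt_exp_smul_const' (𝕂 := ℝ) A t).clm_apply
    (hasDerivAt_const t x₀)).hasDerivWithinAt.congr_deriv (by simp)

/-- From 1 - y ≤ exp(-y) with y = Kx. The factor `x` is the source of the short-time smallness. -/
lemma gronwallBound_zero_le {K ε x : ℝ} (hK : 0 ≤ K) (hε : 0 ≤ ε) :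
    gronwallBound 0 K ε x ≤ ε * x * Real.exp (K * x) := by
  rcases hK.eq_or_lt with rfl | hK
  · simp [gronwallBound_K0]
  · rw [gronwallBound_of_K_ne_0 hK.ne']
    change 0 * Real.exp (K * x) + ε / K * (Real.exp (K * x) - 1) ≤ _
    rw [zero_mul, zero_add, div_mul_eq_mul_div,
      div_le_iff₀ hK]
    have h := Real.add_one_le_exp (-(K * x))
    rw [Real.exp_neg] at h
    have he := Real.exp_pos (K * x)
    have h2 : Real.exp (K * x) - 1 ≤ K * x * Real.exp (K * x) := by
      have := mul_le_mul_of_nonneg_right h he.le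
      rw [inv_mul_cancel₀ he.ne'] at this
      linarith
    nlinarith [mul_le_mul_of_nonneg_left h2 hε]

/-- A form of Grönwall's inequality on `[0,T]`, with derivatives within `[0,T]`. -/
lemma norm_le_gronwallBound_of_hasDerivWithinAt {f f' : ℝ → E} {δ K ε T : ℝ}
    (hf : ∀ t ∈ Icc 0 T, HasDerivWithinAt f (f' t) (Icc 0 T) t) (h0 : ‖f 0‖ ≤ δ)
    (bound : ∀ t ∈ Icc 0 T, ‖f' t‖ ≤ K * ‖f t‖ + ε) {t : ℝ} (ht : t ∈ Icc 0 T) :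
    ‖f t‖ ≤ gronwallBound δ K ε t := by
  have := norm_le_gronwallBound_of_norm_deriv_right_le (f := f) (f' := f') (δ := δ) (K := K)
    (ε := ε) (fun t ht => (hf t ht).continuousWithinAt)
    (fun t ht => (hf t (Ico_subset_Icc_self ht)).mono_of_mem_nhdsWithin
      (Icc_mem_nhdsGE_of_mem ht)) h0 (fun t ht => bound t (Ico_subset_Icc_self ht)) t ht
  rwa [sub_zero] at this

variable {C : Type*} [NormedAddCommGroup C] [NormedSpace ℝ C]

lemma norm_add_apply_le (A₀ : E →L[ℝ] E) (A₁ : C →L[ℝ] E →L[ℝ] E) {γ : ℝ} {c : C} (hc : ‖c‖ ≤ γ)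
    (x : E) : ‖(A₀ + A₁ c) x‖ ≤ (‖A₀‖ + ‖A₁‖ * γ) * ‖x‖ := by
  refine (ContinuousLinearMap.le_opNorm _ _).trans ?_
  gcongr
  refine (norm_add_le _ _).trans ?_
  gcongr
  exact (A₁.le_opNorm c).trans (by gcongr)

/-- The restriction to `T ≤ 1` makes the bound uniform over both the final time and the ball of
coefficients. -/
lemma norm_le_mul_exp {A₀ : E →L[ℝ] E} {A₁ : C →L[ℝ] E →L[ℝ] E} {γ : ℝ} {c : C} (hc : ‖c‖ ≤ γ)
    {T : ℝ} (hT : T ≤ 1) {x₀ : E} {X : ℝ → E} (hX₀ : X 0 = x₀)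
    (hX : ∀ t ∈ Icc 0 T, HasDerivWithinAt X ((A₀ + A₁ c) (X t)) (Icc 0 T) t)
    {t : ℝ} (ht : t ∈ Icc 0 T) :
    ‖X t‖ ≤ ‖x₀‖ * Real.exp (‖A₀‖ + ‖A₁‖ * γ) := by
  have hγ : 0 ≤ γ := (norm_nonneg c).trans hc
  have h := norm_le_gronwallBound_of_hasDerivWithinAt hX (δ := ‖x₀‖) (K := ‖A₀‖ + ‖A₁‖ * γ)
    (ε := 0) (by rw [hX₀]) (fun t _ => by
      rw [add_zero]; exact norm_add_apply_le A₀ A₁ hc _) ht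
  rw [gronwallBound_ε0] at h
  refine h.trans ?_
  gcongr
  exact mul_le_of_le_one_right (by positivity) (ht.2.trans hT)

lemma norm_le_mul_exp_of_forced {A₀ : E →L[ℝ] E} {A₁ : C →L[ℝ] E →L[ℝ] E} {γ : ℝ} {c : C}
    (hc : ‖c‖ ≤ γ) {T : ℝ} (hT : T ≤ 1) {ε : ℝ} {X F : ℝ → E} (hX₀ : X 0 = 0)
    (hX : ∀ t ∈ Icc 0 T, HasDerivWithinAt X ((A₀ + A₁ c) (X t) + F t) (Icc 0 T) t)
    (hF : ∀ t ∈ Icc 0 T, ‖F t‖ ≤ ε) {t : ℝ} (ht : t ∈ Icc 0 T) :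
    ‖X t‖ ≤ ε * t * Real.exp (‖A₀‖ + ‖A₁‖ * γ) := by
  have hγ : 0 ≤ γ := (norm_nonneg c).trans hc
  have hε : 0 ≤ ε := (norm_nonneg _).trans (hF t ht)
  have h := norm_le_gronwallBound_of_hasDerivWithinAt hX (δ := 0) (K := ‖A₀‖ + ‖A₁‖ * γ)
    (ε := ε) (by rw [hX₀, norm_zero]) (fun t ht =>
      (norm_add_le _ _).trans (add_le_add (norm_add_apply_le A₀ A₁ hc _) (hF t ht))) ht
  refine h.trans ((gronwallBound_zero_le (by positivity) hε).trans ?_)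
  have := ht.1
  gcongr
  exact mul_le_of_le_one_right (by positivity) (ht.2.trans hT)

/-- The second difference in the coefficient of the solutions of a linear evolution equation is
quadratic in the increment, and small for short times. -/
lemma exists_norm_second_difference_le (A₀ : E →L[ℝ] E) (A₁ : C →L[ℝ] E →L[ℝ] E) (γ : ℝ) (x₀ : E) :
    ∃ K : ℝ, 0 ≤ K ∧ ∀ T : ℝ, 0 < T → T ≤ 1 → ∀ (d h : C) (X Y Z : ℝ → E),
      ‖d + h‖ ≤ γ → ‖d - h‖ ≤ γ → ‖d‖ ≤ γ → X 0 = x₀ → Y 0 = x₀ → Z 0 = x₀ →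
      (∀ t ∈ Icc 0 T, HasDerivWithinAt X ((A₀ + A₁ (d + h)) (X t)) (Icc 0 T) t) →
      (∀ t ∈ Icc 0 T, HasDerivWithinAt Y ((A₀ + A₁ (d - h)) (Y t)) (Icc 0 T) t) →
      (∀ t ∈ Icc 0 T, HasDerivWithinAt Z ((A₀ + A₁ d) (Z t)) (Icc 0 T) t) →
      ‖X T + Y T - (2 : ℝ) • Z T‖ ≤ K * T * ‖h‖ ^ 2 := by
  set e := Real.exp (‖A₀‖ + ‖A₁‖ * γ) with he
  set R := ‖x₀‖ * e with hR
  have he0 : 0 ≤ e := (Real.exp_pos _).le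
  refine ⟨‖A₁‖ * (‖A₁‖ * (R + R) * e) * e, by positivity, ?_⟩
  intro T hT0 hT d h X Y Z hdp hdm hd hX₀ hY₀ hZ₀ hX hY hZ
  have hbX := fun t ht => norm_le_mul_exp hdp hT hX₀ hX (t := t) ht
  have hbY := fun t ht => norm_le_mul_exp hdm hT hY₀ hY (t := t) ht
  -- Centring at `d`: (A₀ + A₁(d+h))X - (A₀ + A₁(d-h))Y = (A₀ + A₁d)(X - Y) + A₁h(X + Y).
  have hD : ∀ t ∈ Icc 0 T, ‖X t - Y t‖ ≤ ‖A₁‖ * ‖h‖ * (R + R) * t * e := fun t ht => by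
    refine norm_le_mul_exp_of_forced (A₀ := A₀) (A₁ := A₁) (X := fun t => X t - Y t)
      (F := fun t => A₁ h (X t + Y t)) hd hT (by simp [hX₀, hY₀]) (fun t ht => ?_)
      (fun t ht => ?_) ht
    · refine ((hX t ht).sub (hY t ht)).congr_deriv ?_
      simp only [map_add, map_sub, add_apply, sub_apply]
      abel
    · refine (A₁.le_opNorm₂ _ _).trans ?_
      gcongr
      exact (norm_add_le _ _).trans (add_le_add (hbX t ht) (hbY t ht))
  -- The same centring leaves the forcing A₁h(X - Y), and X - Y is already of order ‖h‖, whence the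
  -- square.
  have hE : ‖X T + Y T - (2 : ℝ) • Z T‖ ≤ ‖A₁‖ * ‖h‖ * (‖A₁‖ * ‖h‖ * (R + R) * e) * T * e := by
    refine norm_le_mul_exp_of_forced (A₀ := A₀) (A₁ := A₁)
      (X := fun t => X t + Y t - (2 : ℝ) • Z t)
      (F := fun t => A₁ h (X t - Y t)) hd hT (by simp [hX₀, hY₀, hZ₀, two_smul])
      (fun t ht => ?_) (fun t ht => ?_) (right_mem_Icc.2 hT0.le)
    · refine (((hX t ht).add (hY t ht)).sub ((hZ t ht).const_smul (2 : ℝ))).congr_deriv ?_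
      simp only [map_add, map_sub, add_apply, sub_apply, two_smul]
      abel
    · refine (A₁.le_opNorm₂ _ _).trans ?_
      gcongr
      exact (hD t ht).trans (mul_le_mul_of_nonneg_right
        (mul_le_of_le_one_right (by positivity) (ht.2.trans hT)) he0)
  refine hE.trans (le_of_eq ?_)
  ring

end Evolution

/-! ### Strong convexity of the cost against its small convexity defect. -/

/-- A lower bound for the convexity defect of half the square of a distance when the midpoint is
perturbed. -/
lemma half_quadratic_midpoint_le {E : Type*} [NormedAddCommGroup E] [NormedSpace ℝ E]
    (B : E →L[ℝ] E →L[ℝ] ℝ) (hB : ∀ x y, B x y = B y x) (hpos : ∀ x, 0 ≤ B x x) (x y z m : E) :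
    2 * (1 / 2 * B (z - m) (z - m)) - ‖B‖ * ‖z - m‖ * ‖x + y - (2 : ℝ) • z‖ ≤
      1 / 2 * B (x - m) (x - m) + 1 / 2 * B (y - m) (y - m) := by
  set p := z - m with hp
  set q := x + y - (2 : ℝ) • z with hq
  have h₁ : -(‖B‖ * ‖p‖ * ‖q‖) ≤ B p q :=
    neg_le_of_abs_le (by simpa using B.le_opNorm₂ p q)
  -- With r = x - y, the right-hand side equals B(p,p) + B(p,q) + B(q,q)/4 + B(r,r)/4; the last two
  -- terms are dropped.
  have h₂ := hpos q
  have h₃ := hpos (x - y)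
  have hx : x - m = p + (1 / 2 : ℝ) • q + (1 / 2 : ℝ) • (x - y) := by
    rw [hp, hq]; module
  have hy : y - m = p + (1 / 2 : ℝ) • q - (1 / 2 : ℝ) • (x - y) := by
    rw [hp, hq]; module
  rw [hx, hy]
  generalize x - y = r at *
  simp only [map_add, map_sub, map_smul, add_apply, sub_apply, smul_apply, smul_eq_mul,
    hB q p, hB r p, hB r q]
  linarith

end Boussinesq

namespace Boussinesq

variable {L β α γ : ℝ}

lemma l2Norm_eq_norm (hL : 0 ≤ L) {c : ℝ → ℝ} {c' : L2Space L}
    (hc : c =ᵐ[volume.restrict (Icc 0 L)] c') : l2Norm L c = ‖c'‖ := by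
  rw [l2Norm, intervalIntegral_eq_integral_restrict hL, ← Real.sqrt_sq (norm_nonneg c'),
    ← real_inner_self_eq_norm_sq, inner_eq_integral]
  congr 1
  refine integral_congr_ae ?_
  filter_upwards [hc] with x hx
  rw [hx, pow_two]

lemma tikhonov_eq (hL : 0 ≤ L) (hβ : 0 ≤ β) {m : (ℝ → ℝ) × (ℝ → ℝ)} {c n v : ℝ → ℝ}
    {c' : L2Space L} {f g a b : MeanZero L} (hc : c =ᵐ[volume.restrict (Icc 0 L)] c')
    (hn : HasH10Deriv L n f) (hv : HasH10Deriv L v g) (ha : HasH10Deriv L m.1 a)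
    (hb : HasH10Deriv L m.2 b) :
    tikhonov L β α m c n v = 1 / 2 * energyForm hL β (f - a) (f - a)
      + 1 / 2 * energyForm hL β (g - b) (g - b) + α / 2 * ‖c'‖ ^ 2 := by
  rw [tikhonov, (hn.sub hL ha).h1Norm_eq hL, (hv.sub hL hb).h1Norm_eq hL, l2Norm_eq_norm hL hc,
    Real.sq_sqrt (energyForm_self_nonneg hL hβ _), Real.sq_sqrt (energyForm_self_nonneg hL hβ _)]

/-- Two points whose common bound on the cost is not improved at their midpoint coincide, for a
strongly convex perturbation of a quadratic cost whose convexity defect is small. -/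
lemma eq_of_cost_le_midpoint {E C : Type*} [NormedAddCommGroup E] [NormedSpace ℝ E]
    [NormedAddCommGroup C] [InnerProductSpace ℝ C]
    (B : E →L[ℝ] E →L[ℝ] ℝ) (hB : ∀ x y, B x y = B y x) (hpos : ∀ x, 0 ≤ B x x)
    {x y z m : E × E} {d h : C} {ρ κ : ℝ} (hz : ‖z‖ ≤ ρ)
    (hq : ‖x + y - (2 : ℝ) • z‖ ≤ κ * ‖h‖ ^ 2) (hκ : 2 * ‖B‖ * (ρ + ‖m‖) * κ < α)
    (hx : 1 / 2 * B (x.1 - m.1) (x.1 - m.1) + 1 / 2 * B (x.2 - m.2) (x.2 - m.2)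
        + α / 2 * ‖d + h‖ ^ 2 ≤
      1 / 2 * B (z.1 - m.1) (z.1 - m.1) + 1 / 2 * B (z.2 - m.2) (z.2 - m.2) + α / 2 * ‖d‖ ^ 2)
    (hy : 1 / 2 * B (y.1 - m.1) (y.1 - m.1) + 1 / 2 * B (y.2 - m.2) (y.2 - m.2)
        + α / 2 * ‖d - h‖ ^ 2 ≤
      1 / 2 * B (z.1 - m.1) (z.1 - m.1) + 1 / 2 * B (z.2 - m.2) (z.2 - m.2) + α / 2 * ‖d‖ ^ 2) :
    h = 0 := by
  have hzm : ‖z - m‖ ≤ ρ + ‖m‖ := (norm_sub_le _ _).trans (by gcongr)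
  have hρ : 0 ≤ ρ + ‖m‖ := (norm_nonneg _).trans hzm
  have h₁ := half_quadratic_midpoint_le B hB hpos x.1 y.1 z.1 m.1
  have h₂ := half_quadratic_midpoint_le B hB hpos x.2 y.2 z.2 m.2
  have h₃ : ‖B‖ * ‖z.1 - m.1‖ * ‖x.1 + y.1 - (2 : ℝ) • z.1‖ ≤
      ‖B‖ * (ρ + ‖m‖) * (κ * ‖h‖ ^ 2) := by
    gcongr
    · exact (norm_fst_le (z - m)).trans hzm
    · exact (norm_fst_le (x + y - (2 : ℝ) • z)).trans hq
  have h₄ : ‖B‖ * ‖z.2 - m.2‖ * ‖x.2 + y.2 - (2 : ℝ) • z.2‖ ≤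
      ‖B‖ * (ρ + ‖m‖) * (κ * ‖h‖ ^ 2) := by
    gcongr
    · exact (norm_snd_le (z - m)).trans hzm
    · exact (norm_snd_le (x + y - (2 : ℝ) • z)).trans hq
  have h₅ := parallelogram_law_with_norm ℝ d h
  have h₆ : α / 2 * (‖d + h‖ ^ 2 + ‖d - h‖ ^ 2) = α * (‖d‖ ^ 2 + ‖h‖ ^ 2) := by
    linear_combination α / 2 * h₅
  -- Adding `hx` and `hy` gives α‖h‖² ≤ 2‖B‖(ρ + ‖m‖)κ‖h‖², the factor 2 counting the two
  -- components; this contradicts `hκ` when h ≠ 0.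
  by_contra hh
  have h₇ : 0 < ‖h‖ ^ 2 := by positivity
  nlinarith [mul_lt_mul_of_pos_right hκ h₇]

/-- For short times, two coefficients whose final costs are both at most that of their midpoint
coincide; here the coefficients are `d + h` and `d - h`. -/
lemma exists_time_forall_eq_zero {E C : Type*} [NormedAddCommGroup E] [NormedSpace ℝ E]
    [NormedAddCommGroup C] [InnerProductSpace ℝ C]
    (B : E →L[ℝ] E →L[ℝ] ℝ) (hB : ∀ x y, B x y = B y x) (hpos : ∀ x, 0 ≤ B x x)
    (A₀ : E × E →L[ℝ] E × E) (A₁ : C →L[ℝ] E × E →L[ℝ] E × E) (hα : 0 < α) (γ : ℝ)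
    (x₀ m : E × E) :
    ∃ T₀ : ℝ, 0 < T₀ ∧ ∀ T : ℝ, 0 < T → T ≤ T₀ → ∀ (d h : C) (X Y Z : ℝ → E × E),
      ‖d + h‖ ≤ γ → ‖d - h‖ ≤ γ → ‖d‖ ≤ γ → X 0 = x₀ → Y 0 = x₀ → Z 0 = x₀ →
      (∀ t ∈ Icc 0 T, HasDerivWithinAt X ((A₀ + A₁ (d + h)) (X t)) (Icc 0 T) t) →
      (∀ t ∈ Icc 0 T, HasDerivWithinAt Y ((A₀ + A₁ (d - h)) (Y t)) (Icc 0 T) t) →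
      (∀ t ∈ Icc 0 T, HasDerivWithinAt Z ((A₀ + A₁ d) (Z t)) (Icc 0 T) t) →
      1 / 2 * B ((X T).1 - m.1) ((X T).1 - m.1) + 1 / 2 * B ((X T).2 - m.2) ((X T).2 - m.2)
          + α / 2 * ‖d + h‖ ^ 2 ≤
        1 / 2 * B ((Z T).1 - m.1) ((Z T).1 - m.1) + 1 / 2 * B ((Z T).2 - m.2) ((Z T).2 - m.2)
          + α / 2 * ‖d‖ ^ 2 →
      1 / 2 * B ((Y T).1 - m.1) ((Y T).1 - m.1) + 1 / 2 * B ((Y T).2 - m.2) ((Y T).2 - m.2)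
          + α / 2 * ‖d - h‖ ^ 2 ≤
        1 / 2 * B ((Z T).1 - m.1) ((Z T).1 - m.1) + 1 / 2 * B ((Z T).2 - m.2) ((Z T).2 - m.2)
          + α / 2 * ‖d‖ ^ 2 →
      h = 0 := by
  obtain ⟨K, hK₀, hK⟩ := exists_norm_second_difference_le A₀ A₁ γ x₀
  set ρ := ‖x₀‖ * Real.exp (‖A₀‖ + ‖A₁‖ * γ) with hρ
  set Q := 2 * ‖B‖ * (ρ + ‖m‖) * K with hQ
  have hQ₀ : 0 ≤ Q := by positivity
  -- The 1 permits the uniform Grönwall bounds; `Q + 1` avoids division by zero and makes QT < α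
  -- strict.
  refine ⟨min 1 (α / (Q + 1)), by positivity, ?_⟩
  intro T hT hTT d h X Y Z hk hk' hd hX₀ hY₀ hZ₀ hX hY hZ hcX hcY
  have hT₁ : T ≤ 1 := hTT.trans (min_le_left _ _)
  have hT₂ : T * (Q + 1) ≤ α := (le_div_iff₀ (by positivity)).1 (hTT.trans (min_le_right _ _))
  refine eq_of_cost_le_midpoint B hB hpos (m := m) (ρ := ρ) (κ := K * T)
    (norm_le_mul_exp hd hT₁ hZ₀ hZ (right_mem_Icc.2 hT.le))
    (hK T hT hT₁ d h X Y Z hk hk' hd hX₀ hY₀ hZ₀ hX hY hZ) ?_ hcX hcY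
  rw [← mul_assoc, ← hQ]
  linarith

end Boussinesq

theorem mainTheorem2 (L β α γ : ℝ) (hL : 0 < L) (hβ : 0 < β) (hα : 0 < α)
    (N₀ V₀ : ℝ → ℝ) (hN₀ : MemH10 L N₀) (hV₀ : MemH10 L V₀)
    (m m' : (ℝ → ℝ) × (ℝ → ℝ))
    (hm₁ : MemH10 L m.1) (hm₂ : MemH10 L m.2) (hm'₁ : MemH10 L m'.1) (hm'₂ : MemH10 L m'.2)
    (hmm' : ∀ ξ ∈ Set.Icc 0 L, m.1 ξ = m'.1 ξ ∧ m.2 ξ = m'.2 ξ) :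
    ∃ T₀ : ℝ, 0 < T₀ ∧ ∀ T : ℝ, 0 < T → T ≤ T₀ → ∀ c c' : ℝ → ℝ,
      IsOptimal L β α γ T N₀ V₀ m c → IsOptimal L β α γ T N₀ V₀ m' c' →
        ∀ᵐ ξ ∂(MeasureTheory.volume.restrict (Set.Icc 0 L)), c ξ = c' ξ := by
  have hL' := hL.le
  obtain ⟨f₀, hf₀⟩ := hN₀.exists_hasH10Deriv hL'
  obtain ⟨g₀, hg₀⟩ := hV₀.exists_hasH10Deriv hL'
  obtain ⟨a, ha⟩ := hm₁.exists_hasH10Deriv hL'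
  obtain ⟨b, hb⟩ := hm₂.exists_hasH10Deriv hL'
  -- Both measurements are represented by the same pair `(a, b)`, so both optima minimize one and
  -- the same cost.
  have ha' : HasH10Deriv L m'.1 a := by
    obtain ⟨a', ha'⟩ := hm'₁.exists_hasH10Deriv hL'
    rwa [ha.unique ha' fun x hx => (hmm' x hx).1]
  have hb' : HasH10Deriv L m'.2 b := by
    obtain ⟨b', hb'⟩ := hm'₂.exists_hasH10Deriv hL'
    rwa [hb.unique hb' fun x hx => (hmm' x hx).2]
  obtain ⟨T₀, hT₀, key⟩ := exists_time_forall_eq_zero (energyForm hL' β) (energyForm_comm hL' β)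
    (energyForm_self_nonneg hL' hβ.le) (freeOperator hL' hβ) (coeffOperator hL' hβ) hα γ
    (f₀, g₀) (a, b)
  refine ⟨T₀, hT₀, fun T hT hTT c c' hc hc' => ?_⟩
  obtain ⟨hcA, N, V, hNV, hmin⟩ := hc
  obtain ⟨hcA', N', V', hNV', hmin'⟩ := hc'
  have hcc := hcA.1.coeFn_toLp.symm
  have hcc' := hcA'.1.coeFn_toLp.symm
  set k : L2Space L := hcA.1.toLp c
  set k' : L2Space L := hcA'.1.toLp c'
  have hk : ‖k‖ ≤ γ := (l2Norm_eq_norm hL' hcc).symm.trans_le hcA.2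
  have hk' : ‖k'‖ ≤ γ := (l2Norm_eq_norm hL' hcc').symm.trans_le hcA'.2
  set d : L2Space L := (1 / 2 : ℝ) • (k + k') with hd
  set h : L2Space L := (1 / 2 : ℝ) • (k - k') with hh
  have hkd : k = d + h := by rw [hd, hh]; module
  have hkd' : k' = d - h := by rw [hd, hh]; module
  -- The admissible ball is convex, so it contains the midpoint.
  have hdγ : ‖d‖ ≤ γ := by
    rw [hd, norm_smul, Real.norm_of_nonneg (by norm_num)]
    linarith [norm_add_le k k']
  have hdd : (d : ℝ → ℝ) =ᵐ[volume.restrict (Icc 0 L)] d := EventuallyEq.rfl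
  have hdA : Admissible L γ d := ⟨d.memL2, (l2Norm_eq_norm hL' hdd).trans_le hdγ⟩
  obtain ⟨X, hX₀, hXr, hX⟩ := hNV.exists_hasDerivWithinAt hL' hβ hT.le hcc hf₀ hg₀
  obtain ⟨Y, hY₀, hYr, hY⟩ := hNV'.exists_hasDerivWithinAt hL' hβ hT.le hcc' hf₀ hg₀
  obtain ⟨Z, hZ₀, hZ⟩ := exists_hasDerivWithinAt_of_linear
    (freeOperator hL' hβ + coeffOperator hL' hβ d) (f₀, g₀) (Icc 0 T)
  have hZs := isSolution_of_hasDerivWithinAt hL' hβ hdd hf₀ hg₀ hZ₀ fun t _ => hZ t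
  have hTm : T ∈ Icc 0 T := right_mem_Icc.2 hT.le
  -- The optima are not compared with each other, only each with the midpoint.
  have h₁ := hmin _ _ _ hdA hZs
  have h₂ := hmin' _ _ _ hdA hZs
  have hp := hasH10Deriv_primitive hL'
  rw [tikhonov_eq hL' hβ.le hcc (hXr T hTm).1 (hXr T hTm).2 ha hb,
    tikhonov_eq hL' hβ.le hdd (hp _) (hp _) ha hb] at h₁
  rw [tikhonov_eq hL' hβ.le hcc' (hYr T hTm).1 (hYr T hTm).2 ha' hb',
    tikhonov_eq hL' hβ.le hdd (hp _) (hp _) ha' hb'] at h₂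
  rw [hkd] at hk hX h₁
  rw [hkd'] at hk' hY h₂
  have h0 : h = 0 := key T hT hTT d h X Y Z hk hk' hdγ hX₀ hY₀ hZ₀ hX hY (fun t _ => hZ t) h₁ h₂
  have hkk : k = k' := by rw [hkd, hkd', h0, add_zero, sub_zero]
  rw [hkk] at hcc
  exact hcc.trans hcc'.symm
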